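/- For $\phi\in L^2(\mathbb R)$ (complex-valued) let $$\mathcal W(\phi,\phi)(x,\xi)=\int_{\mathbb R}e^{-2i\pi z\xi}\,\phi\bigl(x+\tfrac z2\bigr)\,\overline{\phi\bigl(x-\tfrac z2\bigr)}\,dz,\qquad (x,\xi)\in\mathbb R^2,$$ be its (real-valued) Wigner distribution. For $\theta\in(0,\pi)$ let $$\Sigma_\theta=\{(x,\xi)\in\mathbb R^2\setminus((-\infty,0]\times\{0\}):\ \arg(x+i\xi)\in(0,\theta)\}.$$ A convex affine cone with aperture strictly less than $\pi$ and vertex $X_0\in\mathbb R^2$ is a set $X_0+R\,\Sigma_\theta$ with $\theta\in(0,\pi)$ and $R$ a rotation of $\mathbb R^2$ about the origin. Let $C$ be such a cone with vertex $X_0$, and let $K\subset\overline{C}$ be a Lebesgue measurable set that contains a neighbourhood of the vertex in the cone, i.e. $U\cap C\subset K$ for some neighbourhood $U$ of $X_0$ in $\mathbb R^2$. Then there exists $\lambda>0$ such that, with $K_\lambda=X_0+\lambda(K-X_0)$, there exists $\phi$ in the Schwartz space $\mathscr S(\mathbb R)$ for which $\mathcal W(\phi,\phi)$ is integrable on $K_\lambda$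 and $$\iint_{K_\lambda}\mathcal W(\phi,\phi)(x,\xi)\,dx\,d\xi>\|\phi\|_{L^2(\mathbb R)}^2 .$$ If moreover $K$ is convex, then $K_\lambda$ is a counterexample to Flandrin's conjecture (which asserts that $\iint_D\mathcal W(u,u)\,dx\,d\xi\le\|u\|_{L^2(\mathbb R)}^2$ for every convex $D\subset\mathbb R^2$ and every $u\in L^2(\mathbb R)$): $K_\lambda$ is convex, and there is $u\in L^2(\mathbb R)$ such that $\mathcal W(u,u)$ is integrable on $K_\lambda$ and $\iint_{K_\lambda}\mathcal W(u,u)\,dx\,d\xi>\|u\|_{L^2(\mathbb R)}^2$. -/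

import Mathlib

open MeasureTheory Set Topology
open scoped SchwartzMap

noncomputable section

/-- The joint Wigner distribution
`W(u,v)(x,ξ) = ∫ e^{-2iπzξ} u(x + z/2) conj(v(x - z/2)) dz` on the phase space `ℝ × ℝ`. -/
def wigner (u v : ℝ → ℂ) (X : ℝ × ℝ) : ℂ :=
  ∫ z : ℝ, Complex.exp (-2 * Complex.I * Real.pi * z * X.2) *
    (u (X.1 + z / 2) * (starRingEnd ℂ) (v (X.1 - z / 2)))

theorem conj_wigner (u v : ℝ → ℂ) (X : ℝ × ℝ) :
    (starRingEnd ℂ) (wigner u v X) = wigner v u X := by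
  unfold wigner
  rw [← integral_conj, ← integral_neg_eq_self]
  congr 1
  funext z
  simp only [map_mul, ← Complex.exp_conj, Complex.conj_conj, map_neg, Complex.conj_I,
    Complex.conj_ofReal, Complex.ofReal_neg, map_ofNat]
  rw [show X.1 + -z / 2 = X.1 - z / 2 by ring, show X.1 - -z / 2 = X.1 + z / 2 by ring,
    mul_comm (v _)]
  congr 2
  ring

/-- `W(u,u)` is real-valued; hence its real part, used below, is `W(u,u)` itself. -/
theorem wigner_self_eq_re (u : ℝ → ℂ) (X : ℝ × ℝ) :
    wigner u u X = ((wigner u u X).re : ℂ) :=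
  (Complex.conj_eq_iff_re.mp (conj_wigner u u X)).symm

/-- The cone `Σ_θ = {(x,ξ) ∉ ℝ₋ × {0} : arg (x + iξ) ∈ (0,θ)}`
(`Complex.slitPlane` is the complement of the closed negative half-axis). -/
def sector (θ : ℝ) : Set (ℝ × ℝ) :=
  {X | (⟨X.1, X.2⟩ : ℂ) ∈ Complex.slitPlane ∧ Complex.arg ⟨X.1, X.2⟩ ∈ Ioo 0 θ}

/-- The rotation of angle `α` about the origin. -/
def planeRotation (α : ℝ) (X : ℝ × ℝ) : ℝ × ℝ :=
  (Real.cos α * X.1 - Real.sin α * X.2, Real.sin α * X.1 + Real.cos α * X.2)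

/-- `C` is a convex affine cone with aperture strictly less than `π` and vertex `X₀`: the
translate by `X₀` of a rotation of `Σ_θ` for some `θ ∈ (0,π)`. -/
def IsConvexAffineCone (C : Set (ℝ × ℝ)) (X₀ : ℝ × ℝ) : Prop :=
  ∃ α : ℝ, ∃ θ ∈ Ioo 0 Real.pi, C = (fun X => X₀ + planeRotation α X) '' sector θ

/-- The dilate `X₀ + r (K - X₀)`. -/
def dilate (X₀ : ℝ × ℝ) (r : ℝ) (K : Set (ℝ × ℝ)) : Set (ℝ × ℝ) :=
  (fun X => X₀ + r • (X - X₀)) '' K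

/-- `D` is a counterexample to Flandrin's conjecture, which asserts
`∬_D W(u,u) ≤ ‖u‖²` for all `u ∈ L²(ℝ)` and all convex `D`. -/
def IsFlandrinCounterexample (D : Set (ℝ × ℝ)) : Prop :=
  Convex ℝ D ∧ ∃ u : Lp ℂ 2 (volume : Measure ℝ),
    IntegrableOn (wigner u u) D ∧ ‖u‖ ^ 2 < ∫ X in D, (wigner u u X).re

end

/-! The heart is one Schwartz function whose Wigner mass on the open first quadrant exceeds its
squared norm. Take `u` supported in `s ≥ 1`, let `v` be its reflection, and superpose `f = e^{2iπNz}
u` and `β g` with `g = e^{-2iπNz} v`. With `m = ‖u‖²`, disjoint supports make the squared norm `m +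
β² m`. On the quadrant `W(g,g)` vanishes, and `W(f,f)` contributes `m` minus a Fourier tail of size
`O(N⁻⁴)`. The cross term contributes `2β Re ∬ e^{4iπNx} W(u,v)`, and the jump of the indicator at
the sides of the quadrant makes this integral decay only like `c / N`, with `c > 0`. Hence the
excess is about `2βc/N - β² m`; for `β = c/(mN)` it equals `c²/(m N²)` to leading order, which beats
the tail when `N` is large (`exists_quadrant_excess_eq`, `tendsto_mul_integral_quadrant_cross`,
`exists_norm_sq_lt_integral_quadrant`).

A cone of aperture less than `π` is the preimage of the quadrant under an affine map with linear
part of determinant one. Such maps preserve area, and Wigner distributions are covariant under them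
(`isWignerCovariant_symplectic`), so the excess transfers to every such cone. Finally the dilates of
`K` fill the cone up to a null set, and `W(φ,φ)` is integrable on the plane, so dominated
convergence keeps the strict inequality for some large dilate
(`IsConvexAffineCone.tendsto_integral_dilate`). -/

open scoped FourierTransform ComplexConjugate

/-! ### Operations on Schwartz functions -/

namespace SchwartzMap

theorem norm_toLp_two_sq (f : 𝓢(ℝ, ℂ)) :
    ‖f.toLp 2 (volume : Measure ℝ)‖ ^ 2 = ∫ x, ‖f x‖ ^ 2 := by
  have h := inner_toL2_toL2_eq f f
  rw [inner_self_eq_norm_sq_to_K] at h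
  apply Complex.ofRealLI.injective
  rw [← LinearIsometry.integral_comp_comm]
  simpa [inner_self_eq_norm_sq_to_K] using h

theorem exists_comp_affine (u : 𝓢(ℝ, ℂ)) {a : ℝ} (ha : a ≠ 0) (b : ℝ) :
    ∃ w : 𝓢(ℝ, ℂ), ∀ z, w z = u (a * z + b) := by
  have h1 : (fun z : ℝ => a * z + b).HasTemperateGrowth := by fun_prop
  have h2 : AntilipschitzWith ‖a‖₊⁻¹ (fun z : ℝ => a * z + b) := by
    apply AntilipschitzWith.of_le_mul_dist
    intro x y
    rw [Real.dist_eq, Real.dist_eq, add_sub_add_right_eq_sub, ← mul_sub, abs_mul]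
    simp [ha]
  exact ⟨compCLMOfAntilipschitz ℝ h1 h2 u, fun _ => rfl⟩

theorem exists_mul (u v : 𝓢(ℝ, ℂ)) : ∃ w : 𝓢(ℝ, ℂ), ∀ z, w z = u z * v z :=
  ⟨pairing (ContinuousLinearMap.mul ℝ ℂ) u v, fun _ => rfl⟩

theorem exists_conj (u : 𝓢(ℝ, ℂ)) : ∃ w : 𝓢(ℝ, ℂ), ∀ z, w z = conj (u z) :=
  ⟨postcompCLM (Complex.conjCLE : ℂ →L[ℝ] ℂ) u, fun _ => rfl⟩

theorem exists_slice (u v : 𝓢(ℝ, ℂ)) (x : ℝ) :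
    ∃ w : 𝓢(ℝ, ℂ), ∀ z, w z = u (x + z / 2) * conj (v (x - z / 2)) := by
  obtain ⟨u', hu⟩ := u.exists_comp_affine (a := 1 / 2) (by norm_num) x
  obtain ⟨v', hv⟩ := v.exists_comp_affine (a := -1 / 2) (by norm_num) x
  obtain ⟨v'', hv'⟩ := v'.exists_conj
  obtain ⟨w, hw⟩ := u'.exists_mul v''
  refine ⟨w, fun z => ?_⟩
  rw [hw, hu, hv', hv]
  ring_nf

end SchwartzMap

/-! ### Decay and integrability of Wigner distributions -/

theorem wigner_eq_fourier (u v : ℝ → ℂ) (X : ℝ × ℝ) :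
    wigner u v X = 𝓕 (fun z : ℝ => u (X.1 + z / 2) * conj (v (X.1 - z / 2))) X.2 := by
  rw [Real.fourier_real_eq_integral_exp_smul]
  unfold wigner
  congr 1
  funext z
  rw [smul_eq_mul]
  congr 2
  push_cast
  ring

theorem integrable_slice (u v : 𝓢(ℝ, ℂ)) (x : ℝ) :
    Integrable (fun z : ℝ => u (x + z / 2) * conj (v (x - z / 2))) := by
  obtain ⟨w, hw⟩ := u.exists_slice v x
  simpa only [← hw] using w.integrable

theorem integrable_wigner_integrand (u v : 𝓢(ℝ, ℂ)) (x ξ : ℝ) :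
    Integrable (fun z : ℝ => Complex.exp (-2 * Complex.I * Real.pi * z * ξ) *
      (u (x + z / 2) * conj (v (x - z / 2)))) := by
  refine (integrable_slice u v x).bdd_mul (c := 1) (by fun_prop) (Filter.Eventually.of_forall fun z => ?_)
  rw [show (-2 * Complex.I * Real.pi * z * ξ : ℂ) = ((-2 * Real.pi * z * ξ : ℝ) : ℂ) * Complex.I by
    push_cast; ring, Complex.norm_exp_ofReal_mul_I]

/-- Expanding gives `(1 + (x+y)²)(1 + (x-y)²) ≥ 1 + x² + y²` with `y = z/2`, and the square of the
right side dominates `(1 + x²)(1 + y²)`. This is why each factor is bounded by a multiple of `(1 +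
s²)⁻²`. -/
theorem exists_norm_slice_le (u v : 𝓢(ℝ, ℂ)) :
    ∃ C, 0 ≤ C ∧ ∀ x z : ℝ, ‖u (x + z / 2) * conj (v (x - z / 2))‖ ≤
      C * (1 + x ^ 2)⁻¹ * (1 + (z / 2) ^ 2)⁻¹ := by
  have key : ∀ w : 𝓢(ℝ, ℂ), ∃ C, 0 ≤ C ∧ ∀ s, (1 + s ^ 2) ^ 2 * ‖w s‖ ≤ C := by
    intro w
    refine ⟨SchwartzMap.seminorm ℝ 0 0 w + 2 * SchwartzMap.seminorm ℝ 2 0 w +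
      SchwartzMap.seminorm ℝ 4 0 w, by positivity, fun s => ?_⟩
    have h0 := w.norm_pow_mul_le_seminorm ℝ 0 s
    have h2 := w.norm_pow_mul_le_seminorm ℝ 2 s
    have h4 := w.norm_pow_mul_le_seminorm ℝ 4 s
    simp only [Real.norm_eq_abs, pow_zero, one_mul, sq_abs] at h0 h2 h4
    rw [show |s| ^ 4 = s ^ 4 by rw [← abs_pow]; exact abs_of_nonneg (by positivity)] at h4
    nlinarith
  obtain ⟨A, hA, hu⟩ := key u
  obtain ⟨B, hB, hv⟩ := key v
  refine ⟨A * B, mul_nonneg hA hB, fun x z => ?_⟩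
  have h1 := mul_le_mul (hu (x + z / 2)) (hv (x - z / 2)) (by positivity) hA
  rw [norm_mul, RCLike.norm_conj, mul_assoc, ← mul_inv, ← div_eq_mul_inv, le_div_iff₀ (by positivity)]
  refine le_trans ?_ h1
  rw [show (1 + (x + z / 2) ^ 2) ^ 2 * ‖u (x + z / 2)‖ *
      ((1 + (x - z / 2) ^ 2) ^ 2 * ‖v (x - z / 2)‖) = ‖u (x + z / 2)‖ * ‖v (x - z / 2)‖ *
      ((1 + (x + z / 2) ^ 2) * (1 + (x - z / 2) ^ 2)) ^ 2 by ring]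
  refine mul_le_mul_of_nonneg_left ?_ (by positivity)
  have h3 : 1 + x ^ 2 + (z / 2) ^ 2 ≤ (1 + (x + z / 2) ^ 2) * (1 + (x - z / 2) ^ 2) := by
    nlinarith [sq_nonneg x, sq_nonneg (z / 2), mul_nonneg (sq_nonneg (x + z / 2)) (sq_nonneg (x - z / 2))]
  refine le_trans ?_ (pow_le_pow_left₀ (by positivity) h3 2)
  nlinarith [sq_nonneg x, sq_nonneg (z / 2), mul_nonneg (sq_nonneg x) (sq_nonneg (z / 2)),
    sq_nonneg (x ^ 2), sq_nonneg ((z / 2) ^ 2)]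

theorem exists_norm_wigner_le (u v : 𝓢(ℝ, ℂ)) :
    ∃ C, ∀ X : ℝ × ℝ, ‖wigner u v X‖ ≤ C * (1 + X.1 ^ 2)⁻¹ := by
  obtain ⟨C, hC, h⟩ := exists_norm_slice_le u v
  have hint : Integrable (fun z : ℝ => (1 + (z / 2) ^ 2)⁻¹) := by
    exact integrable_inv_one_add_sq.comp_div two_ne_zero
  refine ⟨C * ∫ z : ℝ, (1 + (z / 2) ^ 2)⁻¹, fun X => ?_⟩
  have h1 : ‖wigner u v X‖ ≤ ∫ z : ℝ, C * (1 + X.1 ^ 2)⁻¹ * (1 + (z / 2) ^ 2)⁻¹ := by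
    refine norm_integral_le_of_norm_le (hint.const_mul _) (Filter.Eventually.of_forall fun z => ?_)
    rw [norm_mul, show (-2 * Complex.I * Real.pi * z * X.2 : ℂ) =
      ((-2 * Real.pi * z * X.2 : ℝ) : ℂ) * Complex.I by
      push_cast; ring, Complex.norm_exp_ofReal_mul_I, one_mul]
    exact h _ _
  rw [integral_const_mul] at h1
  linarith

/-- Multiplication by `2πiξ` is differentiation in `z` before the Fourier transform; the factors
`±1/2` come from `x ± z/2`. Decay in `ξ` thus reduces to decay in `x` for derivatives. -/
theorem two_pi_I_mul_wigner (u v : 𝓢(ℝ, ℂ)) (X : ℝ × ℝ) :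
    2 * Real.pi * Complex.I * X.2 * wigner u v X =
      1 / 2 * wigner (SchwartzMap.derivCLM ℝ ℂ u) v X - 1 / 2 * wigner u (SchwartzMap.derivCLM ℝ ℂ v) X := by
  obtain ⟨w, hw⟩ := u.exists_slice v X.1
  have hw' : (fun z : ℝ => u (X.1 + z / 2) * conj (v (X.1 - z / 2))) = w := by
    funext z; exact (hw z).symm
  have hd : deriv w = fun z : ℝ =>
      (1 / 2 : ℂ) * (SchwartzMap.derivCLM ℝ ℂ u (X.1 + z / 2) * conj (v (X.1 - z / 2))) -
      (1 / 2 : ℂ) * (u (X.1 + z / 2) * conj (SchwartzMap.derivCLM ℝ ℂ v (X.1 - z / 2))) := by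
    funext z
    rw [← hw']
    have h1 : HasDerivAt (fun z : ℝ => u (X.1 + z / 2)) ((1 / 2 : ℝ) • deriv u (X.1 + z / 2)) z :=
      (u.hasDerivAt (X.1 + z / 2)).scomp z (((hasDerivAt_id z).div_const 2).const_add X.1)
    have h2 : HasDerivAt (fun z : ℝ => v (X.1 - z / 2)) ((-(1 / 2) : ℝ) • deriv v (X.1 - z / 2)) z :=
      (v.hasDerivAt (X.1 - z / 2)).scomp z (((hasDerivAt_id z).div_const 2).const_sub X.1)
    have h3 := h1.mul h2.star
    refine h3.deriv.trans ?_
    rw [star_smul, star_trivial (-(1 / 2) : ℝ)]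
    simp only [SchwartzMap.derivCLM_apply, Complex.real_smul, starRingEnd_apply]
    push_cast
    ring
  have h := congr_fun (Real.fourier_deriv w.integrable w.differentiable
    (SchwartzMap.derivCLM ℝ ℂ w).integrable) X.2
  rw [smul_eq_mul, ← hw', ← wigner_eq_fourier, hw', hd, Real.fourier_real_eq_integral_exp_smul] at h
  have e : ∀ z : ℝ, Complex.exp (((-2 * Real.pi * z * X.2 : ℝ) : ℂ) * Complex.I) =
      Complex.exp (-2 * Complex.I * Real.pi * z * X.2) := fun z => by
    congr 1; push_cast; ring
  simp only [e, smul_eq_mul, mul_sub, mul_left_comm _ (1 / 2 : ℂ)] at h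
  rw [integral_sub ((integrable_wigner_integrand _ _ _ _).const_mul _)
    ((integrable_wigner_integrand _ _ _ _).const_mul _), integral_const_mul, integral_const_mul] at h
  exact h.symm

theorem stronglyMeasurable_wigner (u v : 𝓢(ℝ, ℂ)) : StronglyMeasurable (wigner u v) := by
  have h : Continuous (fun p : (ℝ × ℝ) × ℝ => Complex.exp (-2 * Complex.I * Real.pi * p.2 * p.1.2) *
      (u (p.1.1 + p.2 / 2) * conj (v (p.1.1 - p.2 / 2)))) := by
    have := u.continuous
    have := v.continuous
    fun_prop
  exact h.stronglyMeasurable.integral_prod_right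

theorem exists_pow_mul_norm_wigner_le (n : ℕ) (u v : 𝓢(ℝ, ℂ)) :
    ∃ C, ∀ X : ℝ × ℝ, (2 * Real.pi * |X.2|) ^ n * ‖wigner u v X‖ ≤ C * (1 + X.1 ^ 2)⁻¹ := by
  induction n generalizing u v with
  | zero => simpa using exists_norm_wigner_le u v
  | succ n ih =>
    obtain ⟨A, hA⟩ := ih (SchwartzMap.derivCLM ℝ ℂ u) v
    obtain ⟨B, hB⟩ := ih u (SchwartzMap.derivCLM ℝ ℂ v)
    refine ⟨1 / 2 * A + 1 / 2 * B, fun X => ?_⟩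
    have h := congr_arg norm (two_pi_I_mul_wigner u v X)
    have h1 : ‖(2 * Real.pi * Complex.I * X.2 : ℂ)‖ = 2 * Real.pi * |X.2| := by
      simp [abs_of_pos Real.pi_pos]
    rw [norm_mul, h1] at h
    rw [pow_succ, mul_assoc, h]
    have h2 := norm_sub_le (1 / 2 * wigner (SchwartzMap.derivCLM ℝ ℂ u) v X)
      (1 / 2 * wigner u (SchwartzMap.derivCLM ℝ ℂ v) X)
    rw [norm_mul, norm_mul, show ‖(1 / 2 : ℂ)‖ = 1 / 2 by norm_num] at h2
    have h3 := mul_le_mul_of_nonneg_left h2 (show 0 ≤ (2 * Real.pi * |X.2|) ^ n by positivity)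
    linarith [hA X, hB X]

theorem integrable_wigner (u v : 𝓢(ℝ, ℂ)) : Integrable (wigner u v) := by
  obtain ⟨A, hA⟩ := exists_pow_mul_norm_wigner_le 0 u v
  obtain ⟨B, hB⟩ := exists_pow_mul_norm_wigner_le 2 u v
  have hint : Integrable (fun X : ℝ × ℝ => (A + B) * ((1 + X.1 ^ 2)⁻¹ * (1 + X.2 ^ 2)⁻¹)) :=
    (integrable_inv_one_add_sq.mul_prod integrable_inv_one_add_sq).const_mul _
  refine hint.mono' (stronglyMeasurable_wigner u v).aestronglyMeasurable
    (Filter.Eventually.of_forall fun X => ?_)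
  rw [← mul_assoc, ← div_eq_mul_inv _ (1 + X.2 ^ 2), le_div_iff₀ (by positivity)]
  have h1 : (1 : ℝ) ≤ (2 * Real.pi) ^ 2 := by nlinarith [Real.pi_gt_three]
  have h2 := hA X
  have h3 := hB X
  rw [pow_zero, one_mul] at h2
  rw [mul_pow, sq_abs] at h3
  have h4 : X.2 ^ 2 * ‖wigner u v X‖ ≤ (2 * Real.pi) ^ 2 * X.2 ^ 2 * ‖wigner u v X‖ := by
    rw [mul_assoc]
    exact le_mul_of_one_le_left (by positivity) h1
  linarith

/-! ### Covariance under affine symplectic maps -/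

theorem integral_comp_affine (F : ℝ → ℂ) (a b : ℝ) :
    ∫ t : ℝ, F (a * t + b) = |a⁻¹| • ∫ t, F t := by
  rw [Measure.integral_comp_mul_left (fun t => F (t + b)) a, integral_add_right_eq_self]

theorem hasTemperateGrowth_cexp_mul_I :
    (fun x : ℝ => Complex.exp (x * Complex.I)).HasTemperateGrowth := by
  have h : ∀ n : ℕ, iteratedDeriv n (fun x : ℝ => Complex.exp (x * Complex.I)) =
      fun x : ℝ => Complex.I ^ n * Complex.exp (x * Complex.I) := by
    intro n
    induction n with
    | zero => simp
    | succ n ih =>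
      rw [iteratedDeriv_succ, ih]
      funext x
      have h1 : HasDerivAt (fun x : ℝ => Complex.exp (x * Complex.I))
          (Complex.exp (x * Complex.I) * (1 * Complex.I)) x :=
        ((Complex.ofRealCLM.hasDerivAt (x := x)).mul_const Complex.I).cexp
      rw [(h1.const_mul (Complex.I ^ n)).deriv]
      ring
  refine ⟨((Complex.ofRealCLM.contDiff).mul contDiff_const).cexp, fun n => ⟨0, 1, fun x => ?_⟩⟩
  rw [norm_iteratedFDeriv_eq_norm_iteratedDeriv, h]
  simp [Complex.norm_exp_ofReal_mul_I]

theorem SchwartzMap.exists_phase_mul (u : 𝓢(ℝ, ℂ)) {p : ℝ → ℝ} (hp : p.HasTemperateGrowth) :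
    ∃ w : 𝓢(ℝ, ℂ), ∀ z, w z = Complex.exp (p z * Complex.I) * u z :=
  ⟨SchwartzMap.smulLeftCLM ℂ (fun z => Complex.exp (p z * Complex.I)) u, fun _ =>
    SchwartzMap.smulLeftCLM_apply_apply (hasTemperateGrowth_cexp_mul_I.comp hp) _ _⟩

theorem conj_cexp_ofReal_mul_I (r : ℝ) :
    conj (Complex.exp (r * Complex.I)) = Complex.exp ((-r : ℝ) * Complex.I) := by
  rw [← Complex.exp_conj]
  simp

/-- Phase-space maps `g` for which composition with `g` preserves Wigner distributions of Schwartz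
functions, up to an isometric change of the function. -/
def IsWignerCovariant (g : ℝ × ℝ → ℝ × ℝ) : Prop :=
  ∀ u : 𝓢(ℝ, ℂ), ∃ v : 𝓢(ℝ, ℂ), ‖v.toLp 2 (volume : Measure ℝ)‖ = ‖u.toLp 2 (volume : Measure ℝ)‖ ∧
    ∀ X, wigner v v X = wigner u u (g X)

theorem IsWignerCovariant.comp {g h : ℝ × ℝ → ℝ × ℝ} (hg : IsWignerCovariant g)
    (hh : IsWignerCovariant h) : IsWignerCovariant (g ∘ h) := by
  intro u
  obtain ⟨v, hv, hv'⟩ := hg u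
  obtain ⟨w, hw, hw'⟩ := hh v
  exact ⟨w, hw.trans hv, fun X => by rw [hw', hv', Function.comp_apply]⟩

theorem norm_toLp_eq_of_integral_eq {u v : 𝓢(ℝ, ℂ)} (h : ∫ x, ‖v x‖ ^ 2 = ∫ x, ‖u x‖ ^ 2) :
    ‖v.toLp 2 (volume : Measure ℝ)‖ = ‖u.toLp 2 (volume : Measure ℝ)‖ := by
  rw [← SchwartzMap.norm_toLp_two_sq, ← SchwartzMap.norm_toLp_two_sq] at h
  exact (pow_left_inj₀ (norm_nonneg _) (norm_nonneg _) two_ne_zero).mp h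

theorem isWignerCovariant_sub (X₀ : ℝ × ℝ) : IsWignerCovariant (fun X => X - X₀) := by
  intro u
  obtain ⟨u', hu'⟩ := u.exists_comp_affine one_ne_zero (-X₀.1)
  obtain ⟨v, hv⟩ := u'.exists_phase_mul (p := fun z => 2 * Real.pi * X₀.2 * z) (by fun_prop)
  refine ⟨v, norm_toLp_eq_of_integral_eq ?_, fun X => ?_⟩
  · simp only [hv, hu', norm_mul, Complex.norm_exp_ofReal_mul_I, one_mul]
    exact integral_add_right_eq_self (fun x => ‖u x‖ ^ 2) _
  · unfold wigner
    congr 1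
    funext z
    simp only [hv, hu', map_mul, conj_cexp_ofReal_mul_I, Prod.fst_sub, Prod.snd_sub, one_mul]
    rw [show X.1 + z / 2 + -X₀.1 = X.1 - X₀.1 + z / 2 by ring,
      show X.1 - z / 2 + -X₀.1 = X.1 - X₀.1 - z / 2 by ring,
      mul_mul_mul_comm (Complex.exp _) (u _), ← mul_assoc, ← Complex.exp_add, ← Complex.exp_add]
    congr 2
    push_cast
    ring

/-- Since `(x + z/2)² - (x - z/2)² = 2xz`, a quadratic phase on `u` becomes a phase linear in `z`,
which shifts the frequency proportionally to `x`. -/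
theorem isWignerCovariant_shear (t : ℝ) :
    IsWignerCovariant (fun X => (X.1, t * X.1 + X.2)) := by
  intro u
  obtain ⟨v, hv⟩ := u.exists_phase_mul (p := fun z => -Real.pi * t * z ^ 2) (by fun_prop)
  refine ⟨v, norm_toLp_eq_of_integral_eq ?_, fun X => ?_⟩
  · simp only [hv, norm_mul, Complex.norm_exp_ofReal_mul_I, one_mul]
  · unfold wigner
    congr 1
    funext z
    simp only [hv, map_mul, conj_cexp_ofReal_mul_I]
    rw [mul_mul_mul_comm (Complex.exp _) (u _), ← mul_assoc, ← Complex.exp_add, ← Complex.exp_add]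
    congr 2
    push_cast
    ring

theorem isWignerCovariant_dilation {b : ℝ} (hb : b ≠ 0) :
    IsWignerCovariant (fun X => (b * X.1, b⁻¹ * X.2)) := by
  intro u
  obtain ⟨v, hv⟩ := u.exists_comp_affine hb 0
  have hb' : |b| ≠ 0 := abs_ne_zero.mpr hb
  have hs : ((Real.sqrt |b| : ℝ) : ℂ) * (Real.sqrt |b| : ℝ) = (|b| : ℝ) := by
    rw [← Complex.ofReal_mul, Real.mul_self_sqrt (abs_nonneg b)]
  refine ⟨((Real.sqrt |b| : ℝ) : ℂ) • v, norm_toLp_eq_of_integral_eq ?_, fun X => ?_⟩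
  · simp only [smul_apply, smul_eq_mul, norm_mul, mul_pow, hv, add_zero, Complex.norm_real,
      Real.norm_eq_abs, sq_abs, Real.sq_sqrt (abs_nonneg b)]
    rw [integral_const_mul, Measure.integral_comp_mul_left (fun x => ‖u x‖ ^ 2), smul_eq_mul,
      abs_inv, mul_inv_cancel_left₀ hb']
  · unfold wigner
    have h := integral_comp_affine (fun z : ℝ =>
      Complex.exp (-2 * Complex.I * Real.pi * z * (b⁻¹ * X.2 : ℝ)) *
        (u (b * X.1 + z / 2) * conj (u (b * X.1 - z / 2)))) b 0
    have h' : ∀ I : ℂ, I = (|b| : ℝ) * (|b⁻¹| • I) := fun I => by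
      rw [Complex.real_smul, ← mul_assoc, ← Complex.ofReal_mul, abs_inv, mul_inv_cancel₀ hb']
      simp
    refine Eq.trans ?_ (h' _).symm
    rw [← h, ← integral_const_mul]
    congr 1
    funext z
    simp only [smul_apply, smul_eq_mul, hv, add_zero, map_mul, Complex.conj_ofReal]
    rw [mul_mul_mul_comm _ (u _), hs]
    rw [show b * (X.1 + z / 2) = b * X.1 + b * z / 2 by ring,
      show b * (X.1 - z / 2) = b * X.1 - b * z / 2 by ring,
      show (-2 * Complex.I * Real.pi * (b * z : ℝ) * (b⁻¹ * X.2 : ℝ) : ℂ) =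
        -2 * Complex.I * Real.pi * z * X.2 by
        push_cast
        have : (b : ℂ) ≠ 0 := by exact_mod_cast hb
        field_simp]
    ring

/-- After rescaling, both factors `𝓕 u (x ± z/2)` become Fourier transforms in `z` of modulated
copies `A`, `B` of `u`; the exponential in `zξ` is absorbed by the translation built into `B`.
Parseval removes the transforms, and `w = 4t + 2ξ` recovers a Wigner integral. -/
theorem wigner_fourier (u : 𝓢(ℝ, ℂ)) (X : ℝ × ℝ) :
    wigner (𝓕 u : 𝓢(ℝ, ℂ)) (𝓕 u : 𝓢(ℝ, ℂ)) X = wigner u u (-X.2, X.1) := by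
  obtain ⟨x, ξ⟩ := X
  obtain ⟨a, ha⟩ := u.exists_comp_affine two_ne_zero 0
  obtain ⟨A, hA⟩ := a.exists_phase_mul (p := fun t => -4 * Real.pi * x * t) (by fun_prop)
  obtain ⟨b, hb⟩ := u.exists_comp_affine (neg_ne_zero.mpr two_ne_zero) (-2 * ξ)
  obtain ⟨B, hB⟩ := b.exists_phase_mul (p := fun t => 4 * Real.pi * x * (t + ξ)) (by fun_prop)
  have hFA : ∀ z, 𝓕 u (x + z / 2) = 2 * 𝓕 A z := by
    intro z
    rw [SchwartzMap.fourier_coe, SchwartzMap.fourier_coe, Real.fourier_real_eq_integral_exp_smul,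
      Real.fourier_real_eq_integral_exp_smul]
    have h := integral_comp_affine (fun s : ℝ =>
      Complex.exp ((-2 * Real.pi * s * (x + z / 2) : ℝ) * Complex.I) • u s) 2 0
    rw [show ∀ I : ℂ, |(2 : ℝ)⁻¹| • I = I / 2 by intro I; simp; ring] at h
    rw [eq_div_iff two_ne_zero] at h
    rw [← h, mul_comm _ (2 : ℂ)]
    congr 2
    funext s
    simp only [hA, ha, smul_eq_mul]
    rw [← mul_assoc, ← Complex.exp_add]
    congr 2
    push_cast
    ring
  have hFB : ∀ z, 𝓕 u (x - z / 2) = Complex.exp ((-2 * Real.pi * z * ξ : ℝ) * Complex.I) * (2 * 𝓕 B z) := by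
    intro z
    rw [SchwartzMap.fourier_coe, SchwartzMap.fourier_coe, Real.fourier_real_eq_integral_exp_smul,
      Real.fourier_real_eq_integral_exp_smul]
    have h := integral_comp_affine (fun s : ℝ =>
      Complex.exp ((-2 * Real.pi * s * (x - z / 2) : ℝ) * Complex.I) • u s) (-2) (-2 * ξ)
    rw [show ∀ I : ℂ, |(-2 : ℝ)⁻¹| • I = I / 2 by intro I; simp [abs_inv]; ring] at h
    rw [eq_div_iff two_ne_zero] at h
    rw [← h, mul_comm _ (2 : ℂ), mul_left_comm (Complex.exp _) 2,
      ← integral_const_mul (Complex.exp _)]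
    congr 2
    funext s
    simp only [hB, hb, smul_eq_mul]
    rw [← mul_assoc, ← mul_assoc, ← Complex.exp_add, ← Complex.exp_add]
    congr 2
    push_cast
    ring
  have h1 : wigner (𝓕 u : 𝓢(ℝ, ℂ)) (𝓕 u : 𝓢(ℝ, ℂ)) (x, ξ) = 4 * ∫ z, inner ℂ (𝓕 B z) (𝓕 A z) := by
    unfold wigner
    rw [← integral_const_mul]
    congr 1
    funext z
    simp only [hFA, hFB, map_mul, conj_cexp_ofReal_mul_I, RCLike.inner_apply]
    rw [show (-2 * Complex.I * Real.pi * z * ξ : ℂ) = ((-2 * Real.pi * z * ξ : ℝ) : ℂ) * Complex.I by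
      push_cast; ring]
    have : Complex.exp (((-2 * Real.pi * z * ξ : ℝ) : ℂ) * Complex.I) *
      Complex.exp (((-(-2 * Real.pi * z * ξ) : ℝ) : ℂ) * Complex.I) = 1 := by
      rw [← Complex.exp_add, ← Complex.exp_zero]
      congr 1
      push_cast
      ring
    rw [Complex.conj_ofNat]
    linear_combination 4 * 𝓕 A z * conj (𝓕 B z) * this
  rw [h1, SchwartzMap.integral_inner_fourier_fourier]
  have h := integral_comp_affine (fun w : ℝ => Complex.exp (-2 * Complex.I * Real.pi * w * x) *
    (u (-ξ + w / 2) * conj (u (-ξ - w / 2)))) 4 (2 * ξ)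
  rw [show ∀ I : ℂ, |(4 : ℝ)⁻¹| • I = I / 4 by intro I; simp; ring] at h
  rw [eq_div_iff (show (4 : ℂ) ≠ 0 by norm_num), mul_comm] at h
  refine Eq.trans ?_ h
  congr 2
  funext t
  simp only [hA, hB, ha, hb, RCLike.inner_apply, map_mul, conj_cexp_ofReal_mul_I]
  rw [show -ξ + (4 * t + 2 * ξ) / 2 = 2 * t + 0 by ring, show -ξ - (4 * t + 2 * ξ) / 2 = -2 * t + -2 * ξ by ring,
    mul_mul_mul_comm, ← Complex.exp_add]
  congr 2
  push_cast
  ring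

theorem isWignerCovariant_fourier : IsWignerCovariant (fun X => (-X.2, X.1)) :=
  fun u => ⟨𝓕 u, SchwartzMap.norm_fourier_toL2_eq u, wigner_fourier u⟩

/-- When `b ≠ 0`, a matrix of determinant one factors as shear, dilation, quarter turn, shear. When
`b = 0`, a further quarter turn moves the nonzero entry `a` into that position. -/
theorem isWignerCovariant_symplectic {a b c d : ℝ} (h : a * d - b * c = 1) :
    IsWignerCovariant (fun X => (a * X.1 + b * X.2, c * X.1 + d * X.2)) := by
  have key : ∀ {a b c d : ℝ}, a * d - b * c = 1 → b ≠ 0 →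
      IsWignerCovariant (fun X => (a * X.1 + b * X.2, c * X.1 + d * X.2)) := by
    intro a b c d h hb
    convert! (isWignerCovariant_shear (d / b)).comp
      ((isWignerCovariant_dilation (neg_ne_zero.mpr hb)).comp
        (isWignerCovariant_fourier.comp (isWignerCovariant_shear (a / b)))) using 2 with X
    have hc : c = (a * d - 1) / b := by field_simp; linarith
    simp only [Function.comp_apply, hc]
    ext
    · simp; field_simp; ring
    · simp; field_simp; ring
  by_cases hb : b = 0
  · have ha : a ≠ 0 := by rintro rfl; simp [hb] at h
    convert! (key (a := -b) (b := a) (c := -d) (d := c) (by linarith) ha).comp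
      isWignerCovariant_fourier using 2 with X
    ext <;> simp <;> ring
  · exact key h hb

/-! ### The cross term on the quadrant -/

/-- Here `z` is the difference of the two arguments, so the gap between the supports forces `z ≥ 2`
wherever the product is nonzero. Division by `z` is then harmless. -/
theorem slice_eq_zero {u v : ℝ → ℂ} (hu : ∀ s < 1, u s = 0) (hv : ∀ t > -1, v t = 0) (x : ℝ)
    {z : ℝ} (hz : z < 2) : u (x + z / 2) * conj (v (x - z / 2)) = 0 := by
  rcases lt_or_ge (x + z / 2) 1 with h | h
  · rw [hu _ h, zero_mul]
  · rw [hv _ (by linarith), map_zero, mul_zero]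

theorem norm_inv_mul_slice_le {u v : ℝ → ℂ} (hu : ∀ s < 1, u s = 0) (hv : ∀ t > -1, v t = 0)
    (x z : ℝ) : ‖(z : ℂ)⁻¹ * (u (x + z / 2) * conj (v (x - z / 2)))‖ ≤
      ‖u (x + z / 2) * conj (v (x - z / 2))‖ := by
  rcases lt_or_ge z 2 with h | h
  · rw [slice_eq_zero hu hv x h, mul_zero]
  · rw [norm_mul, norm_inv, Complex.norm_real, Real.norm_eq_abs, abs_of_pos (by linarith)]
    exact mul_le_of_le_one_left (norm_nonneg _) (inv_le_one_of_one_le₀ (by linarith))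

theorem measurable_inv_mul_slice (u v : 𝓢(ℝ, ℂ)) :
    Measurable (fun p : ℝ × ℝ => (p.2 : ℂ)⁻¹ * (u (p.1 + p.2 / 2) * conj (v (p.1 - p.2 / 2)))) := by
  have hu := u.continuous
  have hv := v.continuous
  have h : Continuous (fun p : ℝ × ℝ => u (p.1 + p.2 / 2) * conj (v (p.1 - p.2 / 2))) := by fun_prop
  exact (Complex.measurable_ofReal.comp measurable_snd).inv.mul h.measurable

theorem integrable_inv_mul_slice {u v : 𝓢(ℝ, ℂ)} (hu : ∀ s < 1, u s = 0)
    (hv : ∀ t > -1, v t = 0) (x : ℝ) :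
    Integrable (fun z : ℝ => (z : ℂ)⁻¹ * (u (x + z / 2) * conj (v (x - z / 2)))) :=
  (integrable_slice u v x).mono
    ((measurable_inv_mul_slice u v).comp measurable_prodMk_left).aestronglyMeasurable
    (Filter.Eventually.of_forall fun z => norm_inv_mul_slice_le hu hv x z)

theorem integrable_inv_mul_slice_prod {u v : 𝓢(ℝ, ℂ)} (hu : ∀ s < 1, u s = 0)
    (hv : ∀ t > -1, v t = 0) :
    Integrable (fun p : ℝ × ℝ => (p.2 : ℂ)⁻¹ * (u (p.1 + p.2 / 2) * conj (v (p.1 - p.2 / 2)))) := by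
  obtain ⟨C, hC, h⟩ := exists_norm_slice_le u v
  have hint : Integrable (fun p : ℝ × ℝ => (C * (1 + p.1 ^ 2)⁻¹) * (1 + (p.2 / 2) ^ 2)⁻¹) :=
    (integrable_inv_one_add_sq.const_mul C).mul_prod (integrable_inv_one_add_sq.comp_div two_ne_zero)
  exact hint.mono' (measurable_inv_mul_slice u v).aestronglyMeasurable
    (Filter.Eventually.of_forall fun p => (norm_inv_mul_slice_le hu hv p.1 p.2).trans (h _ _))

/-- Dividing the slice by `z` integrates its Fourier transform: `-(2πi)⁻¹ 𝓕 G` is a primitive in `ξ`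
that vanishes at infinity by Riemann–Lebesgue, so only its value at `ξ = 0` remains. -/
theorem integral_Ioi_wigner {u v : 𝓢(ℝ, ℂ)} (hu : ∀ s < 1, u s = 0) (hv : ∀ t > -1, v t = 0)
    (x : ℝ) : ∫ ξ in Ioi 0, wigner u v (x, ξ) =
      (2 * Real.pi * Complex.I)⁻¹ * ∫ z : ℝ, (z : ℂ)⁻¹ * (u (x + z / 2) * conj (v (x - z / 2))) := by
  obtain ⟨w, hw⟩ := u.exists_slice v x
  have hG := integrable_inv_mul_slice hu hv x
  set G : ℝ → ℂ := fun z : ℝ => (z : ℂ)⁻¹ * (u (x + z / 2) * conj (v (x - z / 2))) with hGdef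
  have hzG : ∀ z : ℝ, (z : ℂ) * G z = w z := by
    intro z
    rw [hw, hGdef]
    -- The convention `0⁻¹ = 0` costs nothing, because the slice itself vanishes at `z = 0`.
    rcases eq_or_ne z 0 with h | h
    · simp only []
      rw [slice_eq_zero hu hv x (by linarith), mul_zero, mul_zero]
    · have : (z : ℂ) ≠ 0 := by exact_mod_cast h
      field_simp
  have hW : ∀ ξ, wigner u v (x, ξ) = 𝓕 w ξ := by
    intro ξ
    rw [wigner_eq_fourier, SchwartzMap.fourier_coe]
    exact congr_arg (fun F : ℝ → ℂ => 𝓕 F ξ) (funext fun z => (hw z).symm)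
  have hpi : (2 * Real.pi * Complex.I : ℂ) ≠ 0 := by simp [Real.pi_ne_zero]
  have hd : ∀ ξ, HasDerivAt (fun ξ => -(2 * Real.pi * Complex.I)⁻¹ * 𝓕 G ξ) (𝓕 w ξ) ξ := by
    intro ξ
    have h1 := (Real.hasDerivAt_fourier hG (by
      refine w.integrable.congr (Filter.Eventually.of_forall fun z => ?_)
      rw [← hzG]
      exact (Complex.real_smul).symm) ξ).const_mul (-(2 * Real.pi * Complex.I : ℂ)⁻¹)
    convert! h1 using 1
    have : (fun z : ℝ => (-2 * Real.pi * Complex.I * z : ℂ) • G z) =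
        (-2 * Real.pi * Complex.I : ℂ) • (w : ℝ → ℂ) := by
      funext z
      rw [Pi.smul_apply, ← hzG, smul_eq_mul, smul_eq_mul, mul_assoc]
    rw [this, SchwartzMap.fourier_coe, Real.fourier_real_eq_integral_exp_smul,
      Real.fourier_real_eq_integral_exp_smul, ← integral_const_mul]
    congr 1
    funext z
    simp only [Pi.smul_apply, smul_eq_mul]
    field_simp
  have hlim : Filter.Tendsto (fun ξ => -(2 * Real.pi * Complex.I)⁻¹ * 𝓕 G ξ) Filter.atTop (𝓝 0) := by
    have := ((Real.zero_at_infty_fourier G).mono_left atTop_le_cocompact).const_mul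
      (-(2 * Real.pi * Complex.I : ℂ)⁻¹)
    simpa using this
  have hfin := integral_Ioi_of_hasDerivAt_of_tendsto' (a := 0) (fun ξ _ => hd ξ)
    (𝓕 w : 𝓢(ℝ, ℂ)).integrable.integrableOn hlim
  simp only [hW]
  rw [hfin, Real.fourier_real_eq_integral_exp_smul]
  simp

theorem deriv_eq_zero_of_forall_lt {u : ℝ → ℂ} {a : ℝ} (hu : ∀ s < a, u s = 0) :
    ∀ s < a, deriv u s = 0 := by
  intro s hs
  have : u =ᶠ[𝓝 s] fun _ => 0 := by
    filter_upwards [Iio_mem_nhds hs] with t ht using hu t ht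
  rw [this.deriv_eq, deriv_const]

theorem deriv_eq_zero_of_forall_gt {u : ℝ → ℂ} {a : ℝ} (hu : ∀ s > a, u s = 0) :
    ∀ s > a, deriv u s = 0 := by
  intro s hs
  have : u =ᶠ[𝓝 s] fun _ => 0 := by
    filter_upwards [Ioi_mem_nhds hs] with t ht using hu t ht
  rw [this.deriv_eq, deriv_const]

/-- Differentiation preserves the support gap, so both differentiated integrands have the same kind
of domination. The formula supplies the integrable derivative needed to integrate by parts in `x`.
-/
theorem hasDerivAt_integral_inv_mul_slice {u v : 𝓢(ℝ, ℂ)} (hu : ∀ s < 1, u s = 0)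
    (hv : ∀ t > -1, v t = 0) (x : ℝ) :
    HasDerivAt (fun x : ℝ => ∫ z : ℝ, (z : ℂ)⁻¹ * (u (x + z / 2) * conj (v (x - z / 2))))
      ((∫ z : ℝ, (z : ℂ)⁻¹ * (SchwartzMap.derivCLM ℝ ℂ u (x + z / 2) * conj (v (x - z / 2)))) +
        ∫ z : ℝ, (z : ℂ)⁻¹ * (u (x + z / 2) * conj (SchwartzMap.derivCLM ℝ ℂ v (x - z / 2)))) x := by
  have hu' : ∀ s < 1, SchwartzMap.derivCLM ℝ ℂ u s = 0 := deriv_eq_zero_of_forall_lt hu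
  have hv' : ∀ t > -1, SchwartzMap.derivCLM ℝ ℂ v t = 0 := deriv_eq_zero_of_forall_gt hv
  obtain ⟨A, hA, hA'⟩ := exists_norm_slice_le (SchwartzMap.derivCLM ℝ ℂ u) v
  obtain ⟨B, hB, hB'⟩ := exists_norm_slice_le u (SchwartzMap.derivCLM ℝ ℂ v)
  have h1 := integrable_inv_mul_slice hu' hv x
  have h2 := integrable_inv_mul_slice hu hv' x
  rw [← integral_add h1 h2]
  refine (hasDerivAt_integral_of_dominated_loc_of_deriv_le (s := univ)
    (bound := fun z => (A + B) * (1 + (z / 2) ^ 2)⁻¹)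
    (F' := fun (x z : ℝ) =>
      (z : ℂ)⁻¹ * (SchwartzMap.derivCLM ℝ ℂ u (x + z / 2) * conj (v (x - z / 2))) +
      (z : ℂ)⁻¹ * (u (x + z / 2) * conj (SchwartzMap.derivCLM ℝ ℂ v (x - z / 2)))) Filter.univ_mem
    (Filter.Eventually.of_forall fun y => (integrable_inv_mul_slice hu hv y).aestronglyMeasurable)
    (integrable_inv_mul_slice hu hv x) (h1.add h2).aestronglyMeasurable
    (Filter.Eventually.of_forall fun z y _ => ?_)
    ((integrable_inv_one_add_sq.comp_div two_ne_zero).const_mul _)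
    (Filter.Eventually.of_forall fun z y _ => ?_)).2
  · refine (norm_add_le _ _).trans ?_
    have hy : (1 + y ^ 2)⁻¹ ≤ 1 := inv_le_one_of_one_le₀ (by nlinarith [sq_nonneg y])
    have hz : 0 ≤ (1 + (z / 2) ^ 2)⁻¹ := by positivity
    rw [add_mul]
    refine add_le_add (((norm_inv_mul_slice_le hu' hv y z).trans (hA' y z)).trans ?_)
      (((norm_inv_mul_slice_le hu hv' y z).trans (hB' y z)).trans ?_)
    · exact mul_le_mul_of_nonneg_right (mul_le_of_le_one_right hA hy) hz
    · exact mul_le_mul_of_nonneg_right (mul_le_of_le_one_right hB hy) hz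
  · have e1 := (u.hasDerivAt (y + z / 2)).comp_add_const y (z / 2)
    have e2 := (v.hasDerivAt (y - z / 2)).comp_sub_const y (z / 2)
    have e3 := (e1.mul e2.star).const_mul ((z : ℂ)⁻¹)
    rw [mul_add] at e3
    exact e3

/-- One integration by parts leaves the boundary term at `0`, of order `1/N`, and a remainder that
is `o(1/N)` by Riemann–Lebesgue. -/
theorem tendsto_mul_integral_exp_mul {k k' : ℝ → ℂ} (hk : ∀ x, HasDerivAt k (k' x) x)
    (hki : Integrable k) (hki' : Integrable k') :
    Filter.Tendsto (fun N : ℝ => N * ∫ x in Ioi (0 : ℝ), Complex.exp (4 * Real.pi * N * x * Complex.I) * k x)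
      Filter.atTop (𝓝 (-(4 * Real.pi * Complex.I)⁻¹ * k 0)) := by
  have hpi : (4 * Real.pi * Complex.I : ℂ) ≠ 0 := by simp [Real.pi_ne_zero]
  have hnorm : ∀ N x : ℝ, ‖Complex.exp (4 * Real.pi * N * x * Complex.I)‖ = 1 := by
    intro N x
    rw [show (4 * Real.pi * N * x : ℂ) = ((4 * Real.pi * N * x : ℝ) : ℂ) by push_cast; ring,
      Complex.norm_exp_ofReal_mul_I]
  have hmul : ∀ (N : ℝ) {g : ℝ → ℂ}, Integrable g →
      Integrable (fun x : ℝ => Complex.exp (4 * Real.pi * N * x * Complex.I) * g x) :=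
    fun N g hg => hg.bdd_mul (c := 1) (by fun_prop)
      (Filter.Eventually.of_forall fun x => (hnorm N x).le)
  have h0 : Filter.Tendsto k Filter.atTop (𝓝 0) :=
    tendsto_zero_of_hasDerivAt_of_integrableOn_Ioi (a := 0) (fun x _ => hk x)
      hki'.integrableOn hki.integrableOn
  have hibp : ∀ N : ℝ, N * ∫ x in Ioi (0 : ℝ), Complex.exp (4 * Real.pi * N * x * Complex.I) * k x =
      -(4 * Real.pi * Complex.I)⁻¹ * (k 0 +
        ∫ x in Ioi (0 : ℝ), Complex.exp (4 * Real.pi * N * x * Complex.I) * k' x) := by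
    intro N
    have hd : ∀ x : ℝ, HasDerivAt (fun x : ℝ => Complex.exp (4 * Real.pi * N * x * Complex.I) * k x)
        (4 * Real.pi * Complex.I * N * (Complex.exp (4 * Real.pi * N * x * Complex.I) * k x) +
          Complex.exp (4 * Real.pi * N * x * Complex.I) * k' x) x := by
      intro x
      have h1 : HasDerivAt (fun x : ℝ => Complex.exp (4 * Real.pi * N * x * Complex.I))
          (Complex.exp (4 * Real.pi * N * x * Complex.I) * (4 * Real.pi * N * 1 * Complex.I)) x :=
        (((Complex.ofRealCLM.hasDerivAt (x := x)).const_mul (4 * Real.pi * N : ℂ)).mul_const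
          Complex.I).cexp
      refine (h1.mul (hk x)).congr_deriv ?_
      ring
    have hlim : Filter.Tendsto (fun x : ℝ => Complex.exp (4 * Real.pi * N * x * Complex.I) * k x)
        Filter.atTop (𝓝 0) := by
      rw [tendsto_zero_iff_norm_tendsto_zero] at h0 ⊢
      simpa only [norm_mul, hnorm, one_mul] using h0
    have h2 := integral_Ioi_of_hasDerivAt_of_tendsto' (a := 0) (fun x _ => hd x)
      (((hmul N hki).const_mul _).add (hmul N hki')).integrableOn hlim
    rw [integral_add ((hmul N hki).const_mul _).integrableOn (hmul N hki').integrableOn,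
      integral_const_mul] at h2
    simp only [Complex.ofReal_zero, mul_zero, zero_mul, Complex.exp_zero, one_mul, zero_sub] at h2
    apply mul_left_cancel₀ hpi
    rw [neg_mul, mul_neg, mul_inv_cancel_left₀ hpi]
    linear_combination h2
  have hRL : Filter.Tendsto
      (fun N : ℝ => ∫ x in Ioi (0 : ℝ), Complex.exp (4 * Real.pi * N * x * Complex.I) * k' x)
      Filter.atTop (𝓝 0) := by
    have h1 : Filter.Tendsto (fun N : ℝ => -2 * N) Filter.atTop (Filter.cocompact ℝ) :=
      (Filter.tendsto_id.const_mul_atTop_of_neg (by norm_num)).mono_right atBot_le_cocompact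
    refine ((Real.zero_at_infty_fourier ((Ioi 0).indicator k')).comp h1).congr fun N => ?_
    rw [Function.comp_apply, Real.fourier_real_eq_integral_exp_smul, ← integral_indicator measurableSet_Ioi]
    congr 1
    funext x
    by_cases hx : x ∈ Ioi (0 : ℝ)
    · rw [indicator_of_mem hx, indicator_of_mem hx, smul_eq_mul]
      congr 2
      push_cast
      ring
    · rw [indicator_of_notMem hx, indicator_of_notMem hx, smul_zero]
  simp only [hibp]
  simpa using (hRL.const_add (k 0)).const_mul (-(4 * Real.pi * Complex.I : ℂ)⁻¹)

/-- The constant is `(2πi)⁻¹ · (-(4πi)⁻¹) = (8π²)⁻¹`: one factor from the edge `ξ = 0`, the other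
from the edge `x = 0`. -/
theorem tendsto_mul_integral_quadrant_cross {u v : 𝓢(ℝ, ℂ)} (hu : ∀ s < 1, u s = 0)
    (hv : ∀ t > -1, v t = 0) :
    Filter.Tendsto (fun N : ℝ => N * ∫ X in Ioi (0 : ℝ) ×ˢ Ioi (0 : ℝ),
        Complex.exp (4 * Real.pi * N * X.1 * Complex.I) * wigner u v X)
      Filter.atTop (𝓝 ((8 * Real.pi ^ 2 : ℂ)⁻¹ *
        ∫ z : ℝ, (z : ℂ)⁻¹ * (u (z / 2) * conj (v (-(z / 2)))))) := by
  have hu' : ∀ s < 1, SchwartzMap.derivCLM ℝ ℂ u s = 0 := deriv_eq_zero_of_forall_lt hu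
  have hv' : ∀ t > -1, SchwartzMap.derivCLM ℝ ℂ v t = 0 := deriv_eq_zero_of_forall_gt hv
  have h := (tendsto_mul_integral_exp_mul (hasDerivAt_integral_inv_mul_slice hu hv)
    (integrable_inv_mul_slice_prod hu hv).integral_prod_left
    ((integrable_inv_mul_slice_prod hu' hv).integral_prod_left.add
      (integrable_inv_mul_slice_prod hu hv').integral_prod_left)).const_mul
        (2 * Real.pi * Complex.I : ℂ)⁻¹
  have hpi : (Real.pi : ℂ) ≠ 0 := by simp [Real.pi_ne_zero]
  convert! h using 2 with N
  · have hint : Integrable (fun X : ℝ × ℝ =>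
        Complex.exp (4 * Real.pi * N * X.1 * Complex.I) * wigner u v X) := by
      refine (integrable_wigner u v).bdd_mul (c := 1) (by fun_prop)
        (Filter.Eventually.of_forall fun X => ?_)
      rw [show (4 * Real.pi * N * X.1 : ℂ) = ((4 * Real.pi * N * X.1 : ℝ) : ℂ) by push_cast; ring,
        Complex.norm_exp_ofReal_mul_I]
    rw [Measure.volume_eq_prod, setIntegral_prod _ hint.integrableOn, mul_left_comm]
    congr 1
    rw [← integral_const_mul]
    congr 1
    funext x
    simp only []
    rw [integral_const_mul, integral_Ioi_wigner hu hv]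
    ring
  · simp only [zero_add, zero_sub]
    field_simp
    rw [Complex.I_sq]
    ring

/-! ### Diagonal terms and the Fourier tail -/

/-- By `wigner_fourier`, `x ↦ W(u,u)(x,ξ)` is, up to `x ↦ -x`, the Fourier transform of the slice of
`𝓕 u` at `ξ`. Its integral is the value of that slice at `0`, by Fourier inversion. -/
theorem integral_wigner_self (u : 𝓢(ℝ, ℂ)) (ξ : ℝ) :
    ∫ x, wigner u u (x, ξ) = ((‖𝓕 u ξ‖ ^ 2 : ℝ) : ℂ) := by
  obtain ⟨w, hw⟩ := (𝓕 u : 𝓢(ℝ, ℂ)).exists_slice (𝓕 u) ξ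
  have h1 : ∀ x, wigner u u (x, ξ) = (𝓕 w : 𝓢(ℝ, ℂ)) (-x) := by
    intro x
    have h := wigner_fourier u (ξ, -x)
    rw [neg_neg] at h
    rw [← h, wigner_eq_fourier, SchwartzMap.fourier_coe]
    exact congr_arg (fun F : ℝ → ℂ => 𝓕 F (-x)) (funext fun z => (hw z).symm)
  have h2 : 𝓕⁻ (𝓕 w : 𝓢(ℝ, ℂ)) = w := FourierTransform.fourierInv_fourier_eq w
  have h3 := DFunLike.congr_fun h2 0
  rw [SchwartzMap.fourierInv_coe, Real.fourierInv_eq', hw] at h3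
  simp only [h1]
  rw [integral_neg_eq_self (fun x => (𝓕 w : 𝓢(ℝ, ℂ)) x)]
  simp only [inner_zero_right, mul_zero, Complex.ofReal_zero, zero_mul, Complex.exp_zero, one_smul,
    zero_div, add_zero, sub_zero, Complex.mul_conj'] at h3
  rw [h3]
  push_cast
  rfl

theorem wigner_eq_zero_of_fst_neg {u : ℝ → ℂ} (hu : ∀ s < 0, u s = 0) {X : ℝ × ℝ} (hX : X.1 < 0) :
    wigner u u X = 0 := by
  unfold wigner
  rw [← integral_zero ℝ ℂ (μ := volume)]
  congr 1
  funext z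
  rcases le_total z 0 with h | h
  · rw [hu (X.1 + z / 2) (by linarith), zero_mul, mul_zero]
  · rw [hu (X.1 - z / 2) (by linarith), map_zero, mul_zero, mul_zero]

theorem wigner_eq_zero_of_fst_pos {u : ℝ → ℂ} (hu : ∀ s > 0, u s = 0) {X : ℝ × ℝ} (hX : 0 < X.1) :
    wigner u u X = 0 := by
  unfold wigner
  rw [← integral_zero ℝ ℂ (μ := volume)]
  congr 1
  funext z
  rcases le_total z 0 with h | h
  · rw [hu (X.1 - z / 2) (by linarith), map_zero, mul_zero, mul_zero]
  · rw [hu (X.1 + z / 2) (by linarith), zero_mul, mul_zero]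

theorem wigner_modulate_self {u f : ℝ → ℂ} {N : ℝ}
    (hf : ∀ z, f z = Complex.exp ((2 * Real.pi * N * z : ℝ) * Complex.I) * u z) (X : ℝ × ℝ) :
    wigner f f X = wigner u u (X.1, X.2 - N) := by
  unfold wigner
  congr 1
  funext z
  simp only [hf, map_mul, conj_cexp_ofReal_mul_I]
  rw [mul_mul_mul_comm (Complex.exp _) (u _), ← mul_assoc, ← Complex.exp_add, ← Complex.exp_add]
  congr 2
  push_cast
  ring

/-- Opposite frequencies average to zero, so `ξ` is not shifted; their difference `2N` appears as an
oscillation in `x`. -/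
theorem wigner_modulate_cross {u v f g : ℝ → ℂ} {N : ℝ}
    (hf : ∀ z, f z = Complex.exp ((2 * Real.pi * N * z : ℝ) * Complex.I) * u z)
    (hg : ∀ z, g z = Complex.exp ((-(2 * Real.pi * N * z) : ℝ) * Complex.I) * v z) (X : ℝ × ℝ) :
    wigner f g X = Complex.exp (4 * Real.pi * N * X.1 * Complex.I) * wigner u v X := by
  unfold wigner
  rw [← integral_const_mul]
  congr 1
  funext z
  simp only [hf, hg, map_mul, conj_cexp_ofReal_mul_I]
  have h : Complex.exp (-2 * Complex.I * Real.pi * z * X.2) *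
      (Complex.exp ((2 * Real.pi * N * (X.1 + z / 2) : ℝ) * Complex.I) *
        Complex.exp ((-(-(2 * Real.pi * N * (X.1 - z / 2))) : ℝ) * Complex.I)) =
      Complex.exp (4 * Real.pi * N * X.1 * Complex.I) *
        Complex.exp (-2 * Complex.I * Real.pi * z * X.2) := by
    rw [← Complex.exp_add, ← Complex.exp_add, ← Complex.exp_add]
    congr 1
    push_cast
    ring
  linear_combination u (X.1 + z / 2) * conj (v (X.1 - z / 2)) * h

theorem integral_quadrant_wigner_modulate {u f : 𝓢(ℝ, ℂ)} {N : ℝ} (hu : ∀ s < 1, u s = 0)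
    (hf : ∀ z, f z = Complex.exp ((2 * Real.pi * N * z : ℝ) * Complex.I) * u z) :
    ∫ X in Ioi (0 : ℝ) ×ˢ Ioi (0 : ℝ), wigner f f X =
      ((∫ ξ in Ioi 0, ‖𝓕 u (ξ - N)‖ ^ 2 : ℝ) : ℂ) := by
  have hu0 : ∀ s < 0, u s = 0 := fun s hs => hu s (hs.trans one_pos)
  have hint := (integrable_wigner f f).swap
  rw [Measure.volume_eq_prod, ← setIntegral_prod_swap, ← integral_complex_ofReal]
  refine (setIntegral_prod (wigner f f ∘ Prod.swap) hint.integrableOn).trans ?_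
  refine setIntegral_congr_fun measurableSet_Ioi fun ξ _ => ?_
  rw [← integral_wigner_self]
  simp only [Function.comp_apply, Prod.swap_prod_mk, wigner_modulate_self hf]
  -- Adding the endpoint makes the complement exactly `x < 0`, where the support of `u` kills the
  -- distribution.
  rw [← integral_Ici_eq_integral_Ioi]
  refine setIntegral_eq_integral_of_forall_compl_eq_zero fun x hx => ?_
  exact wigner_eq_zero_of_fst_neg hu0 (by simpa using hx)

/-- On `ξ ≤ 0` the argument satisfies `|ξ - N| ≥ N`, so a fourth moment of `‖𝓕 u‖²` suffices. The
power `4` makes the tail negligible against a gain of order `N⁻²`. -/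
theorem exists_integral_Iic_fourier_le (u : 𝓢(ℝ, ℂ)) :
    ∃ M, ∀ N : ℝ, 0 < N → N ^ 4 * ∫ ξ in Iic 0, ‖𝓕 u (ξ - N)‖ ^ 2 ≤ M := by
  have hint : Integrable (fun η : ℝ => η ^ 4 * ‖𝓕 u η‖ ^ 2) := by
    have h := (𝓕 u).integrable_pow_mul volume 4
    refine (h.mul_bdd (c := SchwartzMap.seminorm ℝ 0 0 (𝓕 u : 𝓢(ℝ, ℂ)))
      (𝓕 u : 𝓢(ℝ, ℂ)).continuous.norm.aestronglyMeasurable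
      (Filter.Eventually.of_forall fun η => ?_)).congr (Filter.Eventually.of_forall fun η => ?_)
    · rw [norm_norm]
      exact (𝓕 u : 𝓢(ℝ, ℂ)).norm_le_seminorm ℝ η
    · have : |η| ^ 4 = η ^ 4 := by rw [← abs_pow]; exact abs_of_nonneg (by positivity)
      simp only [Real.norm_eq_abs, this]
      ring
  refine ⟨∫ η : ℝ, η ^ 4 * ‖𝓕 u η‖ ^ 2, fun N hN => ?_⟩
  rw [← integral_sub_right_eq_self (fun η : ℝ => η ^ 4 * ‖𝓕 u η‖ ^ 2) N, ← integral_const_mul]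
  have hi := hint.comp_sub_right N
  refine le_trans ?_ (setIntegral_le_integral (s := Iic 0) hi
    (Filter.Eventually.of_forall fun η => by positivity))
  refine integral_mono_of_nonneg (Filter.Eventually.of_forall fun η => by positivity)
    hi.integrableOn ?_
  filter_upwards [ae_restrict_mem measurableSet_Iic] with ξ hξ
  refine mul_le_mul_of_nonneg_right ?_ (by positivity)
  have h1 : N ^ 4 ≤ (N - ξ) ^ 4 := pow_le_pow_left₀ hN.le (by linarith [mem_Iic.mp hξ]) 4
  exact h1.trans_eq (by ring)

/-! ### The superposition and its excess on the quadrant -/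

theorem wigner_add_smul_self {u v w : 𝓢(ℝ, ℂ)} {β : ℝ} (hw : ∀ z, w z = u z + β * v z)
    (X : ℝ × ℝ) : (wigner w w X).re = (wigner u u X).re + 2 * β * (wigner u v X).re +
      β ^ 2 * (wigner v v X).re := by
  have h : wigner w w X = wigner u u X + β * wigner u v X + β * wigner v u X +
      (β : ℂ) ^ 2 * wigner v v X := by
    have huu := integrable_wigner_integrand u u X.1 X.2
    have huv := (integrable_wigner_integrand u v X.1 X.2).const_mul (β : ℂ)
    have hvu := (integrable_wigner_integrand v u X.1 X.2).const_mul (β : ℂ)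
    have hvv := (integrable_wigner_integrand v v X.1 X.2).const_mul ((β : ℂ) ^ 2)
    have h1 := integral_add huu huv
    have h2 := integral_add (huu.add huv) hvu
    have h3 := integral_add ((huu.add huv).add hvu) hvv
    simp only [Pi.add_apply] at h2 h3
    unfold wigner
    rw [← integral_const_mul, ← integral_const_mul, ← integral_const_mul, ← h1, ← h2, ← h3]
    congr 1
    funext z
    simp only [hw, map_add, map_mul, Complex.conj_ofReal]
    ring
  rw [h, ← conj_wigner u v X, ← Complex.ofReal_pow]
  simp only [Complex.add_re, Complex.re_ofReal_mul, Complex.conj_re]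
  ring

theorem exists_schwartzMap_support_Ioo :
    ∃ u : 𝓢(ℝ, ℂ), (∀ s < 1, u s = 0) ∧ ∃ s, u s ≠ 0 := by
  let b : ContDiffBump (3 / 2 : ℝ) := ⟨1 / 8, 1 / 4, by norm_num, by norm_num⟩
  have hc : HasCompactSupport (fun x => (b x : ℂ)) := b.hasCompactSupport.comp_left Complex.ofReal_zero
  refine ⟨hc.toSchwartzMap (Complex.ofRealCLM.contDiff.comp b.contDiff), fun s hs => ?_, 3 / 2, ?_⟩
  · change (b s : ℂ) = 0
    rw [b.zero_of_le_dist, Complex.ofReal_zero]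
    rw [Real.dist_eq, abs_of_neg (by linarith)]
    change (1 / 4 : ℝ) ≤ _
    linarith
  · change (b (3 / 2) : ℂ) ≠ 0
    rw [b.one_of_mem_closedBall (Metric.mem_closedBall_self b.rIn_pos.le)]
    simp

theorem integral_norm_sq_pos {u : 𝓢(ℝ, ℂ)} {s : ℝ} (hs : u s ≠ 0) : 0 < ∫ x, ‖u x‖ ^ 2 := by
  rw [← SchwartzMap.norm_toLp_two_sq]
  refine pow_pos (norm_pos_iff.mpr fun h => hs ?_) 2
  have : u = 0 := SchwartzMap.injective_toLp 2 volume (by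
    change u.toLp 2 volume = (0 : 𝓢(ℝ, ℂ)).toLp 2 volume
    rw [h]; exact (map_zero (SchwartzMap.toLpCLM ℝ ℂ 2 volume)).symm)
  rw [this]; rfl

theorem SchwartzMap.integrable_norm_sq (u : 𝓢(ℝ, ℂ)) : Integrable (fun x => ‖u x‖ ^ 2) :=
  (memLp_two_iff_integrable_sq_norm u.continuous.aestronglyMeasurable).mp (u.memLp 2 volume)

/-- With `w = f + β g`, the `g` term is invisible for `x > 0` but costs `β² ‖u‖²` in the norm, the
`f` term misses only the part of its Fourier mass on `ξ ≤ 0`, and the cross term is the possible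
gain. -/
theorem exists_quadrant_excess_eq {u v : 𝓢(ℝ, ℂ)} (hu : ∀ s < 1, u s = 0) (hv : ∀ z, v z = u (-z))
    (N β : ℝ) : ∃ w : 𝓢(ℝ, ℂ),
      (∫ X in Ioi (0 : ℝ) ×ˢ Ioi (0 : ℝ), (wigner w w X).re) -
          ‖w.toLp 2 (volume : Measure ℝ)‖ ^ 2 =
        2 * β * (∫ X in Ioi (0 : ℝ) ×ˢ Ioi (0 : ℝ),
          Complex.exp (4 * Real.pi * N * X.1 * Complex.I) * wigner u v X).re -
        β ^ 2 * (∫ x, ‖u x‖ ^ 2) - ∫ ξ in Iic 0, ‖𝓕 u (ξ - N)‖ ^ 2 := by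
  have hv0 : ∀ t > -1, v t = 0 := fun t ht => by rw [hv, hu _ (by linarith)]
  obtain ⟨f, hf⟩ := u.exists_phase_mul (p := fun z => 2 * Real.pi * N * z) (by fun_prop)
  obtain ⟨g, hg⟩ := v.exists_phase_mul (p := fun z => -(2 * Real.pi * N * z)) (by fun_prop)
  have hg0 : ∀ s > 0, g s = 0 := fun s hs => by rw [hg, hv0 s (by linarith), mul_zero]
  have hw : ∀ z, (f + (β : ℂ) • g) z = f z + β * g z := fun z => rfl
  refine ⟨f + (β : ℂ) • g, ?_⟩
  have hnorm : ‖(f + (β : ℂ) • g).toLp 2 (volume : Measure ℝ)‖ ^ 2 =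
      (∫ x, ‖u x‖ ^ 2) + β ^ 2 * ∫ x, ‖u x‖ ^ 2 := by
    have h1 : ∀ z, ‖(f + (β : ℂ) • g) z‖ ^ 2 = ‖u z‖ ^ 2 + β ^ 2 * ‖u (-z)‖ ^ 2 := by
      intro z
      rw [hw, ← hv]
      rcases lt_or_ge z 1 with h | h
      · rw [hf, hu z h, mul_zero, zero_add, norm_mul, hg, norm_mul, Complex.norm_exp_ofReal_mul_I,
          one_mul, mul_pow, Complex.norm_real, Real.norm_eq_abs, sq_abs, norm_zero]
        ring
      · rw [hg, hv0 z (by linarith), mul_zero, mul_zero, add_zero, hf, norm_mul,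
          Complex.norm_exp_ofReal_mul_I, one_mul, norm_zero]
        ring
    rw [SchwartzMap.norm_toLp_two_sq]
    simp only [h1]
    rw [integral_add u.integrable_norm_sq ((u.integrable_norm_sq.comp_neg).const_mul _),
      integral_const_mul, integral_neg_eq_self (fun x => ‖u x‖ ^ 2)]
  have hre : ∀ {F : ℝ × ℝ → ℂ}, Integrable F → ∫ X in Ioi (0 : ℝ) ×ˢ Ioi (0 : ℝ), (F X).re =
      (∫ X in Ioi (0 : ℝ) ×ˢ Ioi (0 : ℝ), F X).re :=
    fun hF => Complex.reCLM.integral_comp_comm hF.integrableOn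
  have hff := (integrable_wigner f f).re
  have hfg := ((integrable_wigner f g).re).const_mul (2 * β)
  have hgg : ∫ X in Ioi (0 : ℝ) ×ˢ Ioi (0 : ℝ), β ^ 2 * (wigner g g X).re = 0 := by
    refine setIntegral_eq_zero_of_forall_eq_zero fun X hX => ?_
    rw [wigner_eq_zero_of_fst_pos hg0 hX.1]
    simp
  have hsum : ∫ X in Ioi (0 : ℝ) ×ˢ Ioi (0 : ℝ), (wigner (f + (β : ℂ) • g : 𝓢(ℝ, ℂ))
      (f + (β : ℂ) • g : 𝓢(ℝ, ℂ)) X).re =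
      (∫ X in Ioi (0 : ℝ) ×ˢ Ioi (0 : ℝ), (wigner f f X).re) +
      (∫ X in Ioi (0 : ℝ) ×ˢ Ioi (0 : ℝ), 2 * β * (wigner f g X).re) +
      ∫ X in Ioi (0 : ℝ) ×ˢ Ioi (0 : ℝ), β ^ 2 * (wigner g g X).re := by
    simp only [wigner_add_smul_self hw]
    have h1 := integral_add hff.integrableOn hfg.integrableOn
      (μ := volume.restrict (Ioi (0 : ℝ) ×ˢ Ioi (0 : ℝ)))
    have h2 := integral_add (hff.add hfg).integrableOn
      (((integrable_wigner g g).re).const_mul (β ^ 2)).integrableOn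
      (μ := volume.restrict (Ioi (0 : ℝ) ×ˢ Ioi (0 : ℝ)))
    simp only [Pi.add_apply] at h2
    rw [h1] at h2
    exact h2
  have htail : (∫ ξ in Iic 0, ‖𝓕 u (ξ - N)‖ ^ 2) + ∫ ξ in Ioi 0, ‖𝓕 u (ξ - N)‖ ^ 2 =
      ∫ x, ‖u x‖ ^ 2 := by
    have h := (𝓕 u : 𝓢(ℝ, ℂ)).integrable_norm_sq.comp_sub_right N
    rw [intervalIntegral.integral_Iic_add_Ioi h.integrableOn h.integrableOn,
      integral_sub_right_eq_self (fun ξ => ‖𝓕 u ξ‖ ^ 2), SchwartzMap.integral_norm_sq_fourier]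
  rw [hsum, hgg, hnorm, integral_const_mul, hre (integrable_wigner f f),
    hre (integrable_wigner f g), integral_quadrant_wigner_modulate hu hf, Complex.ofReal_re]
  simp only [wigner_modulate_cross hf hg]
  linarith

/-- The Wigner distribution of a suitable Schwartz function has mass larger than the squared norm
in the first quadrant. -/
theorem exists_norm_sq_lt_integral_quadrant : ∃ w : 𝓢(ℝ, ℂ),
    ‖w.toLp 2 (volume : Measure ℝ)‖ ^ 2 <
      ∫ X in Ioi (0 : ℝ) ×ˢ Ioi (0 : ℝ), (wigner w w X).re := by
  obtain ⟨u, hu, s, hs⟩ := exists_schwartzMap_support_Ioo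
  obtain ⟨v, hv⟩ := u.exists_comp_affine (neg_ne_zero.mpr one_ne_zero) 0
  replace hv : ∀ z, v z = u (-z) := fun z => by rw [hv]; ring_nf
  have hv0 : ∀ t > -1, v t = 0 := fun t ht => by rw [hv, hu _ (by linarith)]
  obtain ⟨M, hM⟩ := exists_integral_Iic_fourier_le u
  set m := ∫ x, ‖u x‖ ^ 2
  have hm : 0 < m := integral_norm_sq_pos hs
  set κ := ∫ z : ℝ, z⁻¹ * ‖u (z / 2)‖ ^ 2
  have hcast : ∀ z : ℝ, (z : ℂ)⁻¹ * (u (z / 2) * conj (v (-(z / 2)))) =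
      ((z⁻¹ * ‖u (z / 2)‖ ^ 2 : ℝ) : ℂ) := by
    intro z
    rw [hv, neg_neg, Complex.mul_conj']
    push_cast
    rfl
  have hκint : Integrable (fun z : ℝ => z⁻¹ * ‖u (z / 2)‖ ^ 2) := by
    have h := (integrable_inv_mul_slice hu hv0 0).re
    simp only [zero_add, zero_sub, hcast] at h
    exact h
  -- The integrand is nonnegative because it is supported in `z ≥ 2`, and it is nonzero on a
  -- nonempty open set.
  have hκ : 0 < κ := by
    have hz : ∀ z : ℝ, z < 2 → u (z / 2) = 0 := fun z hz => hu _ (by linarith)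
    rw [integral_pos_iff_support_of_nonneg _ hκint]
    · have ho : IsOpen ((fun z : ℝ => u (z / 2)) ⁻¹' {0}ᶜ) :=
        isOpen_compl_singleton.preimage (u.continuous.comp (continuous_id.div_const 2))
      refine (ho.measure_pos volume ⟨2 * s, ?_⟩).trans_le (measure_mono fun z hz' => ?_)
      · simpa using hs
      · have hz2 : 2 ≤ z := not_lt.mp fun h => hz' (hz z h)
        have h0 : ‖u (z / 2)‖ ≠ 0 := norm_ne_zero_iff.mpr hz'
        have h1 : z⁻¹ ≠ 0 := inv_ne_zero (by linarith)
        exact mul_ne_zero h1 (pow_ne_zero 2 h0)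
    · intro z
      rcases lt_or_ge z 2 with h | h
      · simp [hz z h]
      · exact mul_nonneg (inv_nonneg.mpr (by linarith)) (by positivity)
  set c := (8 * Real.pi ^ 2)⁻¹ * κ
  have hc : 0 < c := mul_pos (by positivity) hκ
  have hlim : Filter.Tendsto (fun N : ℝ => N * (∫ X in Ioi (0 : ℝ) ×ˢ Ioi (0 : ℝ),
      Complex.exp (4 * Real.pi * N * X.1 * Complex.I) * wigner u v X).re) Filter.atTop (𝓝 c) := by
    have h := (Complex.continuous_re.tendsto _).comp (tendsto_mul_integral_quadrant_cross hu hv0)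
    simp only [hcast] at h
    rw [integral_complex_ofReal] at h
    convert! h using 2 with N
    · simp
    · rw [show (8 * Real.pi ^ 2 : ℂ) = ((8 * Real.pi ^ 2 : ℝ) : ℂ) by push_cast; rfl,
        ← Complex.ofReal_inv, ← Complex.ofReal_mul, Complex.ofReal_re]
  -- This is `N²` times the excess for `β = c/(mN)`, with the tail replaced by its bound `M / N⁴`.
  -- This `β` maximizes `2βc/N - β² m`, and the limit is `c²/m`.
  have hlim2 : Filter.Tendsto (fun N : ℝ => 2 * (c / m) * (N * (∫ X in Ioi (0 : ℝ) ×ˢ Ioi (0 : ℝ),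
      Complex.exp (4 * Real.pi * N * X.1 * Complex.I) * wigner u v X).re) - (c / m) ^ 2 * m -
      M / N ^ 2) Filter.atTop (𝓝 (2 * (c / m) * c - (c / m) ^ 2 * m - 0)) :=
    ((hlim.const_mul _).sub_const _).sub
      (Filter.Tendsto.const_div_atTop (Filter.tendsto_pow_atTop two_ne_zero) M)
  have hpos : 0 < 2 * (c / m) * c - (c / m) ^ 2 * m - 0 := by
    have : 2 * (c / m) * c - (c / m) ^ 2 * m - 0 = c ^ 2 / m := by field_simp; ring
    rw [this]
    positivity
  obtain ⟨N, hN, hN0⟩ := ((hlim2.eventually (lt_mem_nhds hpos)).and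
    (Filter.eventually_gt_atTop 0)).exists
  obtain ⟨w, hw⟩ := exists_quadrant_excess_eq hu hv N (c / m / N)
  refine ⟨w, sub_pos.mp ?_⟩
  rw [hw]
  have hM' := hM N hN0
  set T := ∫ ξ in Iic 0, ‖𝓕 u (ξ - N)‖ ^ 2
  set I := (∫ X in Ioi (0 : ℝ) ×ˢ Ioi (0 : ℝ),
      Complex.exp (4 * Real.pi * N * X.1 * Complex.I) * wigner u v X).re
  have hT : N ^ 2 * T ≤ M / N ^ 2 := by
    rw [le_div_iff₀ (by positivity)]
    exact le_of_eq_of_le (by ring) hM'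
  have h2 : 0 < N ^ 2 * (2 * (c / m / N) * I - (c / m / N) ^ 2 * m - T) := by
    have : N ^ 2 * (2 * (c / m / N) * I - (c / m / N) ^ 2 * m - T) =
        2 * (c / m) * (N * I) - (c / m) ^ 2 * m - N ^ 2 * T := by field_simp
    rw [this]
    linarith
  exact pos_of_mul_pos_right h2 (by positivity)

/-! ### Cones as affine symplectic preimages of the quadrant -/

/-- The two linear forms are `‖z‖ sin (θ - arg z)` and `‖z‖ sin (arg z)`; as `0 < θ < π`, the signs
of these sines locate the argument. -/
theorem mem_sector_iff {θ : ℝ} (hθ : θ ∈ Ioo 0 Real.pi) (X : ℝ × ℝ) :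
    X ∈ sector θ ↔ 0 < Real.sin θ * X.1 - Real.cos θ * X.2 ∧ 0 < X.2 := by
  obtain ⟨x, y⟩ := X
  simp only [sector, mem_ofPred_eq]
  set z : ℂ := ⟨x, y⟩ with hz
  have hx : ‖z‖ * Real.cos z.arg = x := Complex.norm_mul_cos_arg z
  have hy : ‖z‖ * Real.sin z.arg = y := Complex.norm_mul_sin_arg z
  have hsin : Real.sin θ * x - Real.cos θ * y = ‖z‖ * Real.sin (θ - z.arg) := by
    rw [Real.sin_sub, ← hx, ← hy]
    ring
  constructor
  · rintro ⟨hz0, h0, h1⟩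
    have hn : 0 < ‖z‖ := norm_pos_iff.mpr (Complex.slitPlane_ne_zero hz0)
    refine ⟨?_, ?_⟩
    · rw [hsin]
      exact mul_pos hn (Real.sin_pos_of_pos_of_lt_pi (by linarith) (by linarith [hθ.2]))
    · rw [← hy]
      exact mul_pos hn (Real.sin_pos_of_pos_of_lt_pi h0 (by linarith [hθ.2]))
  · rintro ⟨h1, h2⟩
    have hz0 : z ∈ Complex.slitPlane := Or.inr h2.ne'
    have hn : 0 < ‖z‖ := norm_pos_iff.mpr (Complex.slitPlane_ne_zero hz0)
    have harg : 0 ≤ z.arg := Complex.arg_nonneg_iff.mpr h2.le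
    refine ⟨hz0, harg.lt_of_ne' fun h => ?_, ?_⟩
    · rw [h, Real.sin_zero, mul_zero] at hy
      exact h2.ne hy
    · by_contra! h
      rw [hsin] at h1
      have h3 : 0 ≤ Real.sin (z.arg - θ) :=
        Real.sin_nonneg_of_nonneg_of_le_pi (by linarith) (by linarith [Complex.arg_le_pi z, hθ.1])
      rw [← neg_sub, Real.sin_neg] at h1
      nlinarith

/-- Undo the rotation, then divide the first form of `mem_sector_iff` by `sin θ > 0`. This turns it
into a shear `x - cot θ · y`, so the composite matrix has determinant one. -/
theorem IsConvexAffineCone.exists_eq_preimage {C : Set (ℝ × ℝ)} {X₀ : ℝ × ℝ}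
    (hC : IsConvexAffineCone C X₀) : ∃ a b c d : ℝ, a * d - b * c = 1 ∧ ∀ X, X ∈ C ↔
      0 < a * (X - X₀).1 + b * (X - X₀).2 ∧ 0 < c * (X - X₀).1 + d * (X - X₀).2 := by
  obtain ⟨α, θ, hθ, rfl⟩ := hC
  have hs : 0 < Real.sin θ := Real.sin_pos_of_pos_of_lt_pi hθ.1 hθ.2
  have h1 := Real.sin_sq_add_cos_sq α
  refine ⟨Real.cos α + Real.cos θ / Real.sin θ * Real.sin α,
    Real.sin α - Real.cos θ / Real.sin θ * Real.cos α, -Real.sin α, Real.cos α,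
    by linear_combination h1, fun X => ?_⟩
  have hinv : X ∈ (fun X => X₀ + planeRotation α X) '' sector θ ↔
      planeRotation (-α) (X - X₀) ∈ sector θ := by
    constructor
    · rintro ⟨Y, hY, rfl⟩
      convert! hY using 1
      simp only [planeRotation, add_sub_cancel_left, Real.cos_neg, Real.sin_neg]
      ext
      · simp only []
        linear_combination Y.1 * h1
      · simp only []
        linear_combination Y.2 * h1
    · intro h
      refine ⟨_, h, ?_⟩
      simp only [planeRotation, Real.cos_neg, Real.sin_neg]
      ext
      · simp only [Prod.fst_add, Prod.fst_sub]
        linear_combination (X.1 - X₀.1) * h1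
      · simp only [Prod.snd_add, Prod.snd_sub]
        linear_combination (X.2 - X₀.2) * h1
  rw [hinv, mem_sector_iff hθ]
  simp only [planeRotation, Real.cos_neg, Real.sin_neg]
  set p := (X - X₀).1
  set q := (X - X₀).2
  refine and_congr ?_ Iff.rfl
  rw [← mul_pos_iff_of_pos_left hs (b := (_ + _) * p + _)]
  have : Real.sin θ * ((Real.cos α + Real.cos θ / Real.sin θ * Real.sin α) * p +
      (Real.sin α - Real.cos θ / Real.sin θ * Real.cos α) * q) =
      Real.sin θ * (Real.cos α * p - -Real.sin α * q) -
        Real.cos θ * (-Real.sin α * p + Real.cos α * q) := by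
    field_simp
    ring
  rw [this]

theorem measurePreserving_symplectic {a b c d : ℝ} (h : a * d - b * c = 1) :
    MeasurePreserving (fun X : ℝ × ℝ => (a * X.1 + b * X.2, c * X.1 + d * X.2)) := by
  let L := Matrix.toLin (Module.Basis.finTwoProd ℝ) (Module.Basis.finTwoProd ℝ) !![a, b; c, d]
  have hL : (fun X : ℝ × ℝ => (a * X.1 + b * X.2, c * X.1 + d * X.2)) = L := by
    funext X
    exact (Matrix.toLin_finTwoProd_apply a b c d X).symm
  have hdet : LinearMap.det L = 1 := by
    rw [LinearMap.det_toLin, Matrix.det_fin_two_of, h]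
  refine ⟨by fun_prop, ?_⟩
  rw [hL, Measure.map_linearMap_addHaar_eq_smul_addHaar _ (by rw [hdet]; exact one_ne_zero), hdet]
  simp

theorem quasiMeasurePreserving_add_smul {E : Type*} [NormedAddCommGroup E] [NormedSpace ℝ E]
    [MeasurableSpace E] [BorelSpace E] [FiniteDimensional ℝ E] (μ : Measure E) [μ.IsAddHaarMeasure]
    (c : E) {r : ℝ} (hr : r ≠ 0) : Measure.QuasiMeasurePreserving (fun X => c + r • X) μ μ := by
  have h : Measure.QuasiMeasurePreserving (fun X : E => r • X) μ μ := by
    refine ⟨measurable_const_smul r, ?_⟩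
    rw [Measure.map_addHaar_smul μ hr]
    exact Measure.smul_absolutelyContinuous
  exact (measurePreserving_add_left μ c).quasiMeasurePreserving.comp h

/-- The affine maps `z ↦ x ± z/2` pull null sets back to null sets. This lets the Schwartz function
be replaced by the representative of its `L²` class. -/
theorem wigner_congr_ae {u v : ℝ → ℂ} (h : u =ᵐ[volume] v) : wigner u u = wigner v v := by
  funext X
  refine integral_congr_ae ?_
  have h1 := (quasiMeasurePreserving_add_smul (volume : Measure ℝ) X.1
    (r := 1 / 2) (by norm_num)).ae_eq_comp h
  have h2 := (quasiMeasurePreserving_add_smul (volume : Measure ℝ) X.1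
    (r := -1 / 2) (by norm_num)).ae_eq_comp h
  filter_upwards [h1, h2] with z hz1 hz2
  simp only [Function.comp_apply, smul_eq_mul] at hz1 hz2
  rw [show X.1 + z / 2 = X.1 + 1 / 2 * z by ring, show X.1 - z / 2 = X.1 + -1 / 2 * z by ring,
    hz1, hz2]

theorem IsConvexAffineCone.exists_norm_sq_lt_integral {C : Set (ℝ × ℝ)} {X₀ : ℝ × ℝ}
    (hC : IsConvexAffineCone C X₀) : ∃ w : 𝓢(ℝ, ℂ),
      ‖w.toLp 2 (volume : Measure ℝ)‖ ^ 2 < ∫ X in C, (wigner w w X).re := by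
  obtain ⟨a, b, c, d, h, hmem⟩ := hC.exists_eq_preimage
  obtain ⟨u, hu⟩ := exists_norm_sq_lt_integral_quadrant
  obtain ⟨w, hw, hw'⟩ := ((isWignerCovariant_symplectic h).comp (isWignerCovariant_sub X₀)) u
  refine ⟨w, ?_⟩
  have hmp := (measurePreserving_symplectic h).comp (measurePreserving_sub_right volume X₀)
  set g := (fun X : ℝ × ℝ => (a * X.1 + b * X.2, c * X.1 + d * X.2)) ∘ (fun X => X - X₀)
  have hCg : C = g ⁻¹' (Ioi (0 : ℝ) ×ˢ Ioi (0 : ℝ)) := by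
    ext X
    rw [hmem]
    rfl
  rw [hw, hCg]
  simp only [hw']
  have hmeas : AEStronglyMeasurable (fun X => (wigner u u X).re) (Measure.map g volume) := by
    rw [hmp.map_eq]
    exact (integrable_wigner u u).re.aestronglyMeasurable
  rw [← setIntegral_map (measurableSet_Ioi.prod measurableSet_Ioi) hmeas hmp.aemeasurable,
    hmp.map_eq]
  exact hu

/-! ### Dilates of `K` filling the cone -/

theorem dilate_eq_preimage (X₀ : ℝ × ℝ) {r : ℝ} (hr : r ≠ 0) (K : Set (ℝ × ℝ)) :
    dilate X₀ r K = (fun X => X₀ + r⁻¹ • (X - X₀)) ⁻¹' K := by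
  ext X
  constructor
  · rintro ⟨Y, hY, rfl⟩
    simpa [smul_smul, hr] using hY
  · intro h
    exact ⟨_, h, by simp [smul_smul, hr]⟩

theorem convex_dilate (X₀ : ℝ × ℝ) (r : ℝ) {K : Set (ℝ × ℝ)} (hK : Convex ℝ K) :
    Convex ℝ (dilate X₀ r K) := by
  have h := hK.affinity (X₀ - r • X₀) r
  have e : (fun X => X₀ - r • X₀ + r • X) = fun X => X₀ + r • (X - X₀) := by
    funext X
    rw [smul_sub]
    abel
  rw [e] at h
  exact h

theorem NullMeasurableSet.dilate {K : Set (ℝ × ℝ)} (hK : NullMeasurableSet K volume)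
    (X₀ : ℝ × ℝ) {r : ℝ} (hr : r ≠ 0) : NullMeasurableSet (dilate X₀ r K) volume := by
  rw [dilate_eq_preimage X₀ hr]
  have h := quasiMeasurePreserving_add_smul (volume : Measure (ℝ × ℝ)) (X₀ - r⁻¹ • X₀)
    (inv_ne_zero hr)
  convert! hK.preimage h using 2
  funext X
  rw [smul_sub]
  abel

theorem IsConvexAffineCone.isOpen {C : Set (ℝ × ℝ)} {X₀ : ℝ × ℝ} (hC : IsConvexAffineCone C X₀) :
    IsOpen C := by
  obtain ⟨a, b, c, d, -, hmem⟩ := hC.exists_eq_preimage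
  rw [show C = {X | 0 < a * (X - X₀).1 + b * (X - X₀).2} ∩ {X | 0 < c * (X - X₀).1 + d * (X - X₀).2}
    from ext hmem]
  exact (isOpen_lt (by fun_prop) (by fun_prop)).inter (isOpen_lt (by fun_prop) (by fun_prop))

theorem IsConvexAffineCone.convex {C : Set (ℝ × ℝ)} {X₀ : ℝ × ℝ} (hC : IsConvexAffineCone C X₀) :
    Convex ℝ C := by
  obtain ⟨a, b, c, d, -, hmem⟩ := hC.exists_eq_preimage
  intro X hX Y hY s t hs ht hst
  rw [hmem] at hX hY ⊢
  have h1 := convex_Ioi (𝕜 := ℝ) (0 : ℝ) hX.1 hY.1 hs ht hst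
  have h2 := convex_Ioi (𝕜 := ℝ) (0 : ℝ) hX.2 hY.2 hs ht hst
  simp only [mem_Ioi, smul_eq_mul, Prod.fst_sub, Prod.snd_sub, Prod.fst_add, Prod.snd_add,
    Prod.smul_fst, Prod.smul_snd] at h1 h2 ⊢
  refine ⟨h1.trans_eq ?_, h2.trans_eq ?_⟩
  · linear_combination -(a * X₀.1 + b * X₀.2) * hst
  · linear_combination -(c * X₀.1 + d * X₀.2) * hst

theorem IsConvexAffineCone.add_smul_sub_mem {C : Set (ℝ × ℝ)} {X₀ : ℝ × ℝ}
    (hC : IsConvexAffineCone C X₀) {X : ℝ × ℝ} (hX : X ∈ C) {s : ℝ} (hs : 0 < s) :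
    X₀ + s • (X - X₀) ∈ C := by
  obtain ⟨a, b, c, d, -, hmem⟩ := hC.exists_eq_preimage
  rw [hmem] at hX ⊢
  simp only [add_sub_cancel_left, Prod.smul_fst, Prod.smul_snd, smul_eq_mul]
  refine ⟨(mul_pos hs hX.1).trans_eq (by ring), (mul_pos hs hX.2).trans_eq (by ring)⟩

theorem IsConvexAffineCone.mem_closure_of_mem_dilate {C K : Set (ℝ × ℝ)} {X₀ : ℝ × ℝ}
    (hC : IsConvexAffineCone C X₀) (hKC : K ⊆ closure C) {r : ℝ} (hr : 0 < r) {X : ℝ × ℝ}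
    (hX : X ∈ dilate X₀ r K) : X ∈ closure C := by
  obtain ⟨Y, hY, rfl⟩ := hX
  have hmaps : MapsTo (fun X => X₀ + r • (X - X₀)) C C := fun Z hZ => hC.add_smul_sub_mem hZ hr
  exact hmaps.closure (by fun_prop) (hKC hY)

/-- Dominated convergence with bound `‖F‖`. A point of `C`, contracted towards the vertex, stays in
`C` and eventually lies in `K`. A point outside the closure of `C` is in no dilate, and the frontier
is null because `C` is convex. -/
theorem IsConvexAffineCone.tendsto_integral_dilate {K C : Set (ℝ × ℝ)} {X₀ : ℝ × ℝ}
    (hC : IsConvexAffineCone C X₀) (hK : NullMeasurableSet K volume) (hKC : K ⊆ closure C)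
    (hKX : K ∈ 𝓝[C] X₀) {F : ℝ × ℝ → ℝ} (hF : Integrable F) :
    Filter.Tendsto (fun r : ℝ => ∫ X in dilate X₀ r K, F X) Filter.atTop
      (𝓝 (∫ X in C, F X)) := by
  have hpos := Filter.eventually_gt_atTop (0 : ℝ)
  have h : Filter.Tendsto (fun r : ℝ => ∫ X, (dilate X₀ r K).indicator F X) Filter.atTop
      (𝓝 (∫ X, C.indicator F X)) := by
    refine tendsto_integral_filter_of_dominated_convergence (fun X => ‖F X‖) ?_ ?_ hF.norm ?_
    · filter_upwards [hpos] with r hr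
      exact hF.aestronglyMeasurable.indicator₀ (NullMeasurableSet.dilate hK X₀ hr.ne')
    · exact Filter.Eventually.of_forall fun r => Filter.Eventually.of_forall fun X =>
        norm_indicator_le_norm_self F X
    · have hfr : ∀ᵐ X : ℝ × ℝ, X ∉ frontier C :=
        measure_eq_zero_iff_ae_notMem.mp (hC.convex.addHaar_frontier volume)
      filter_upwards [hfr] with X hX
      refine tendsto_const_nhds.congr' ?_
      by_cases hXC : X ∈ C
      · have hlim : Filter.Tendsto (fun r : ℝ => X₀ + r⁻¹ • (X - X₀)) Filter.atTop (𝓝[C] X₀) := by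
          refine tendsto_nhdsWithin_iff.mpr ⟨?_, ?_⟩
          · simpa using ((tendsto_inv_atTop_zero (𝕜 := ℝ)).smul_const (X - X₀)).const_add X₀
          · filter_upwards [hpos] with r hr
            exact hC.add_smul_sub_mem hXC (inv_pos.mpr hr)
        filter_upwards [hlim hKX, hpos] with r hr hr0
        rw [indicator_of_mem hXC, indicator_of_mem]
        rw [dilate_eq_preimage X₀ hr0.ne']
        exact hr
      · filter_upwards [hpos] with r hr
        rw [indicator_of_notMem hXC, indicator_of_notMem]
        intro hXK
        refine hX ⟨hC.mem_closure_of_mem_dilate hKC hr hXK, ?_⟩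
        rwa [hC.isOpen.interior_eq]
  rw [integral_indicator hC.isOpen.measurableSet] at h
  refine h.congr' ?_
  filter_upwards [hpos] with r hr
  exact integral_indicator₀ (NullMeasurableSet.dilate hK X₀ hr.ne')

theorem mainTheorem12 (K C : Set (ℝ × ℝ)) (X₀ : ℝ × ℝ)
    (hC : IsConvexAffineCone C X₀)
    (hKmeas : NullMeasurableSet K volume)
    (hKC : K ⊆ closure C)
    (hKX : K ∈ 𝓝[C] X₀) :
    ∃ r : ℝ, 0 < r ∧
      (∃ φ : 𝓢(ℝ, ℂ),
        IntegrableOn (wigner φ φ) (dilate X₀ r K) ∧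
        ‖φ.toLp 2 (volume : Measure ℝ)‖ ^ 2 < ∫ X in dilate X₀ r K, (wigner φ φ X).re) ∧
      (Convex ℝ K → IsFlandrinCounterexample (dilate X₀ r K)) := by
  obtain ⟨φ, hφ⟩ := hC.exists_norm_sq_lt_integral
  have hlim := hC.tendsto_integral_dilate hKmeas hKC hKX (integrable_wigner φ φ).re
  obtain ⟨r, hr, hr0⟩ := ((hlim.eventually (lt_mem_nhds hφ)).and
    (Filter.eventually_gt_atTop 0)).exists
  refine ⟨r, hr0, ⟨φ, (integrable_wigner φ φ).integrableOn, hr⟩, fun hK =>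
    ⟨convex_dilate X₀ r hK, φ.toLp 2 volume, ?_⟩⟩
  rw [wigner_congr_ae (φ.coeFn_toLp 2 volume)]
  exact ⟨(integrable_wigner φ φ).integrableOn, hr⟩
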